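/- Let $0 < r \le p$ be integers, let $f:\mathbb{R}^{p\times p}\to\mathbb{R}$ be twice continuously differentiable, and define $g:\mathbb{R}^{p\times r}\to\mathbb{R}$ by $g(Y)=f(YY^\top)$. Matrix spaces carry the Euclidean inner product $\langle A,B\rangle=\mathrm{trace}(A^\top B)$. Let $$\mathcal{M}_{r+}=\{X\in\mathbb{R}^{p\times p}: X=X^\top,\ X\succcurlyeq 0,\ \mathrm{rank}(X)=r\},$$ an embedded submanifold of $\mathbb{R}^{p\times p}$ endowed with the induced metric. Write $\nabla g$, $\nabla^2 g$ for the Euclidean gradient and Hessian of $g$, and $\mathrm{grad} f$, $\mathrm{Hess} f$ for the Riemannian gradient and Hessian of $f$ on $\mathcal{M}_{r+}$: $\mathrm{grad} f(X)\in T_X\mathcal{M}_{r+}$ is the unique tangent vector with $\langle \mathrm{grad} f(X),Z\rangle=\mathrm{D}f(X)[Z]$ for all $Z\in T_X\mathcal{M}_{r+}$, and $\mathrm{Hess} f(X)[Z]=\overline{\nabla}_Z\,\mathrm{grad} f(X)$ with $\overline{\nabla}$ the Riemannian connection of $\mathcal{M}_{r+}$. A matrix $Y\in\mathbb{R}^{p\times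 r}$ is a Euclidean first-order stationary point (FOSP) of $g$ if $\nabla g(Y)=0$, and a Euclidean second-order stationary point (SOSP) of $g$ if moreover $\nabla^2 g(Y)\succcurlyeq 0$. A matrix $X\in\mathcal{M}_{r+}$ is a Riemannian FOSP of $f$ if $\mathrm{grad} f(X)=0$, and a Riemannian SOSP of $f$ if moreover $\mathrm{Hess} f(X)\succcurlyeq 0$ on $T_X\mathcal{M}_{r+}$. Then: (a) If $Y\in\mathbb{R}^{p\times r}$ has rank $r$ and is a Euclidean FOSP (respectively SOSP) of $g$, then $X=YY^\top$ is a Riemannian FOSP (respectively SOSP) of $f$ on $\mathcal{M}_{r+}$. (b) If $X$ is a Riemannian FOSP (respectively SOSP) of $f$ on $\mathcal{M}_{r+}$, then every $Y\in\mathbb{R}^{p\times r}$ with $YY^\top=X$ is a Euclidean FOSP (respectively SOSP) of $g$. -/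

import Mathlib

open Set Filter Topology
open scoped ContDiff Matrix Gradient

noncomputable section

/-! ### Euclidean first- and second-order stationary points -/

section Euclidean

variable {E : Type*} [NormedAddCommGroup E] [InnerProductSpace ℝ E] [FiniteDimensional ℝ E]

/-- The Euclidean Hessian `∇²f(x)`: the derivative of the gradient field, a linear operator. -/
def euclideanHessian (f : E → ℝ) (x : E) : E →L[ℝ] E :=
  fderiv ℝ (gradient f) x

/-- `x` is a Euclidean FOSP of `f`: `∇f(x) = 0`. -/
def IsEuclideanFOSP (f : E → ℝ) (x : E) : Prop :=
  gradient f x = 0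

/-- `x` is a Euclidean SOSP of `f`: `∇f(x) = 0` and `∇²f(x) ≽ 0`. (For `f` of class `C²` the
Hessian is self-adjoint, so `≽ 0` is nonnegativity of its quadratic form.) -/
def IsEuclideanSOSP (f : E → ℝ) (x : E) : Prop :=
  gradient f x = 0 ∧ ∀ A : E, 0 ≤ inner ℝ (euclideanHessian f x A) A

end Euclidean

/-! ### Riemannian submanifolds of a Euclidean space

`M ⊆ E` is an embedded submanifold of the Euclidean space `E`, with the metric induced from `E`. -/

section Riemannian

variable {E : Type*} [NormedAddCommGroup E] [InnerProductSpace ℝ E] [FiniteDimensional ℝ E]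

/-- `v` is the velocity at `x` of a smooth curve in `M` through `x`. -/
def IsVelocityAt (M : Set E) (x v : E) : Prop :=
  ∃ (ε : ℝ) (γ : ℝ → E), 0 < ε ∧ ContDiffOn ℝ ∞ γ (Ioo (-ε) ε) ∧
    (∀ t ∈ Ioo (-ε) ε, γ t ∈ M) ∧ γ 0 = x ∧ HasDerivAt γ v 0

/-- The tangent space `T_x M ⊆ E`: the velocities at `x` of smooth curves in `M` through `x`.
(For an embedded submanifold these velocities already form a subspace.) -/
def embTangentSpace (M : Set E) (x : E) : Submodule ℝ E :=
  Submodule.span ℝ {v | IsVelocityAt M x v}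

/-- The Riemannian gradient of `f` on `M` at `x`: the unique `ξ ∈ T_x M` such that
`⟨ξ, Z⟩ = D f(x)[Z]` for all `Z ∈ T_x M` (Riesz representation on `T_x M`). -/
def riemannianGradient (M : Set E) (f : E → ℝ) (x : E) : embTangentSpace M x :=
  (InnerProductSpace.toDual ℝ (embTangentSpace M x)).symm
    ((fderiv ℝ f x).comp (embTangentSpace M x).subtypeL)

/-- The Riemannian (Levi-Civita) connection of a submanifold `M` of a Euclidean space, with the
induced metric: `∇_Z V (x)`, for a tangent vector field `V` on `M` and `Z ∈ T_x M`, is the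
orthogonal projection onto `T_x M` of the derivative of `V` along `M` at `x` in the direction `Z`.
By `riemannianConnection_eq` it does not matter which derivative within `M` is used. -/
def riemannianConnection (M : Set E) (V : E → E) (x : E) :
    embTangentSpace M x →L[ℝ] embTangentSpace M x :=
  (embTangentSpace M x).orthogonalProjectionOnto.comp
    ((fderivWithin ℝ V M x).comp (embTangentSpace M x).subtypeL)

/-- The Riemannian Hessian `Hess f(x)[Z] = ∇_Z grad f (x)`, a linear map of `T_x M` to itself. -/
def riemannianHessian (M : Set E) (f : E → ℝ) (x : E) :
    embTangentSpace M x →L[ℝ] embTangentSpace M x :=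
  riemannianConnection M (fun y => (riemannianGradient M f y : E)) x

/-- `x` is a Riemannian FOSP of `f` on `M`: `x ∈ M` and `grad f(x) = 0`. -/
def IsRiemannianFOSP (M : Set E) (f : E → ℝ) (x : E) : Prop :=
  x ∈ M ∧ riemannianGradient M f x = 0

/-- `x` is a Riemannian SOSP of `f` on `M`: `x ∈ M`, `grad f(x) = 0` and `Hess f(x) ≽ 0`.
(The Riemannian Hessian of a `C²` function is self-adjoint, so `≽ 0` is nonnegativity of its
quadratic form.) -/
def IsRiemannianSOSP (M : Set E) (f : E → ℝ) (x : E) : Prop :=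
  x ∈ M ∧ riemannianGradient M f x = 0 ∧
    ∀ Z : embTangentSpace M x, 0 ≤ inner ℝ (riemannianHessian M f x Z) Z

/-- On tangent vectors, all derivatives of `V` within `M` agree. -/
theorem riemannianConnection_eq {M : Set E} {V : E → E} {x : E} {L : E →L[ℝ] E}
    (hL : HasFDerivWithinAt V L M x) :
    riemannianConnection M V x =
      (embTangentSpace M x).orthogonalProjectionOnto.comp
        (L.comp (embTangentSpace M x).subtypeL) := by
  have key : ∀ v ∈ embTangentSpace M x, fderivWithin ℝ V M x v = L v := by
    intro v hv
    induction hv using Submodule.span_induction with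
    | mem v hv =>
      obtain ⟨ε, γ, hε, -, hM, rfl, hγ⟩ := hv
      have h0 : Ioo (-ε) ε ∈ 𝓝 (0 : ℝ) := Ioo_mem_nhds (by linarith) hε
      have hγ' : HasDerivWithinAt γ v (Ioo (-ε) ε) 0 := hγ.hasDerivWithinAt
      have h1 := (hL.comp_hasDerivWithinAt (0 : ℝ) hγ' hM).hasDerivAt h0
      have h2 := (hL.differentiableWithinAt.hasFDerivWithinAt.comp_hasDerivWithinAt
        (0 : ℝ) hγ' hM).hasDerivAt h0
      exact h2.unique h1
    | zero => simp
    | add u v _ _ hu hv => simp [hu, hv]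
    | smul c v _ hv => simp [hv]
  ext Z
  simp [riemannianConnection, key Z Z.2]

end Riemannian

end

/-! ### Low-rank positive semidefinite matrices -/

attribute [local instance] Matrix.frobeniusNormedAddCommGroup Matrix.frobeniusNormedSpace

/-- The Euclidean (Frobenius) inner product `⟨A, B⟩ = trace(Aᵀ B)` on real matrices. -/
noncomputable instance matrixFrobeniusInnerProductSpace (m n : ℕ) :
    InnerProductSpace ℝ (Matrix (Fin m) (Fin n) ℝ) where
  inner A B := Matrix.trace (Aᵀ * B)
  norm_sq_eq_re_inner A := by
    have h : 0 ≤ ∑ i, ∑ j, ‖A i j‖ ^ (2 : ℝ) :=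
      Finset.sum_nonneg fun i _ => Finset.sum_nonneg fun j _ => by positivity
    rw [Matrix.frobenius_norm_def, ← Real.sqrt_eq_rpow, Real.sq_sqrt h, Finset.sum_comm]
    simp [Matrix.trace, Matrix.mul_apply, pow_two]
  conj_inner_symm A B := by
    simp [Matrix.trace, Matrix.mul_apply, mul_comm]
  add_left A B C := by
    simp [Matrix.add_mul]
  smul_left A B c := by
    simp

/-- The set `M_{r+}` of `p × p` real symmetric positive semidefinite matrices of rank `r`. -/
def psdRankManifold (p r : ℕ) : Set (Matrix (Fin p) (Fin p) ℝ) :=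
  {X | X.PosSemidef ∧ X.rank = r}

/-- The factorized objective `g(Y) = f(Y Yᵀ)` on `p × r` real matrices. -/
noncomputable def psdFactorObjective {p r : ℕ} (f : Matrix (Fin p) (Fin p) ℝ → ℝ) :
    Matrix (Fin p) (Fin r) ℝ → ℝ :=
  fun Y => f (Y * Yᵀ)

/-!
The map `Φ(Y) = Y Yᵀ` parametrizes the manifold `M` of positive semidefinite matrices of rank `r`
by the matrices `Y` of full column rank, with redundancy: its differential
`dΦ_Y[B] = Y Bᵀ + B Yᵀ` is onto the tangent space of `M` at `Y Yᵀ` but in general not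
injective. Surjectivity is all that is needed to compare stationary points of `f` on `M` with those
of `g = f ∘ Φ`.

For the first-order conditions, `Dg(Y) = Df(Φ Y) ∘ dΦ_Y` vanishes exactly when `Df(Φ Y)` vanishes on
the tangent space (`isEuclideanFOSP_comp_iff`). For the second-order conditions, the identity
`⟨∇g(Y), B⟩ = ⟨grad f (Φ Y), dΦ_Y[B]⟩` holds for all `Y` of full rank. Differentiated at a stationary
point it gives `⟨∇²g(Y)[B], B⟩ = ⟨Hess f (Φ Y)[dΦ_Y[B]], dΦ_Y[B]⟩`, because the term with the second
derivative of `Φ` is paired with `grad f (Φ Y) = 0` (`inner_euclideanHessian_comp`). So one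
quadratic form is the pullback of the other along a surjection, and they are nonnegative together.

Two facts about `M` enter. The tangent space at `X` consists of the symmetric matrices whose
compression to `ker X` vanishes, equivalently of the matrices `A X + X Aᵀ`
(`mem_embTangentSpace_psdRankManifold_iff`, `exists_eq_mul_add_mul_transpose`). And the gradient
field is differentiable along `M` (`differentiableWithinAt_riemannianGradient`): it is given by the
symmetric part `S` of `∇f(X)` as `S - (1 - P) S (1 - P)`, where `P` is the projector onto the range
of `X`. Near `X₀ = Y₀ Y₀ᵀ` the range of `X ∈ M` is spanned by the columns of `X Y₀`, so that `P` is
the rational function `X Y₀ (Y₀ᵀ X² Y₀)⁻¹ Y₀ᵀ X` of `X`.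
-/

/-! ### Gradients and parametrizations of embedded submanifolds -/

section Parametrization

variable {E F : Type*} [NormedAddCommGroup E] [InnerProductSpace ℝ E]
  [NormedAddCommGroup F] [InnerProductSpace ℝ F]

/-- The differential in a direction along which the map is a quadratic polynomial. -/
theorem fderiv_apply_eq_of_quadratic {Φ : F → E} {y B : F} {b c : E} (hΦ : DifferentiableAt ℝ Φ y)
    (h : ∀ t : ℝ, Φ (y + t • B) = Φ y + (t • b + t ^ 2 • c)) : fderiv ℝ Φ y B = b := by
  have hline : HasDerivAt (fun t : ℝ => y + t • B) B 0 := by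
    have := ((hasDerivAt_id (0 : ℝ)).smul_const B).const_add y
    rwa [one_smul] at this
  have h1 : HasFDerivAt Φ (fderiv ℝ Φ y) (y + (0 : ℝ) • B) := by
    simpa using hΦ.hasFDerivAt
  have h2 : HasDerivAt (fun t : ℝ => Φ y + (t • b + t ^ 2 • c)) b 0 := by
    have := (((hasDerivAt_id (0 : ℝ)).smul_const b).add
      ((hasDerivAt_pow 2 (0 : ℝ)).smul_const c)).const_add (Φ y)
    have e : (1 : ℝ) • b + ((2 : ℕ) * (0 : ℝ) ^ (2 - 1)) • c = b := by simp
    rwa [e] at this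
  exact (h1.comp_hasDerivAt (0 : ℝ) hline).unique
    (h2.congr_of_eventuallyEq (Eventually.of_forall h))

/-- If a smooth map `Φ` takes values in `M` near `y`, then its differential at `y` takes values in
the tangent space: `t ↦ Φ (y + t • B)` is a smooth curve in `M` with velocity `dΦ_y[B]`. -/
theorem fderiv_mem_embTangentSpace {M : Set E} {Φ : F → E} {y : F} (hΦ : ContDiff ℝ ∞ Φ)
    (hM : ∀ᶠ z in 𝓝 y, Φ z ∈ M) (B : F) :
    fderiv ℝ Φ y B ∈ embTangentSpace M (Φ y) := by
  apply Submodule.subset_span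
  have hline : ContDiff ℝ ∞ fun t : ℝ => y + t • B := by fun_prop
  have hev : ∀ᶠ t : ℝ in 𝓝 0, Φ (y + t • B) ∈ M := by
    have : Tendsto (fun t : ℝ => y + t • B) (𝓝 0) (𝓝 y) := by
      simpa using hline.continuous.tendsto (0 : ℝ)
    exact this.eventually hM
  obtain ⟨ε, hε, hball⟩ := Metric.eventually_nhds_iff.1 hev
  refine ⟨ε, fun t => Φ (y + t • B), hε, (hΦ.comp hline).contDiffOn, fun t ht => ?_, by simp, ?_⟩
  · apply hball
    rw [Real.dist_eq, sub_zero]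
    exact abs_lt.2 ht
  · have h1 : HasDerivAt (fun t : ℝ => y + t • B) B 0 := by
      simpa using ((hasDerivAt_id (0 : ℝ)).smul_const B).const_add y
    have h2 : HasFDerivAt Φ (fderiv ℝ Φ y) (y + (0 : ℝ) • B) := by
      simpa using (hΦ.differentiable (by simp) y).hasFDerivAt
    exact h2.comp_hasDerivAt (0 : ℝ) h1

variable [FiniteDimensional ℝ E] [FiniteDimensional ℝ F]

theorem inner_riemannianGradient (M : Set E) (f : E → ℝ) (x : E) {Z : E}
    (hZ : Z ∈ embTangentSpace M x) :
    inner ℝ (riemannianGradient M f x : E) Z = fderiv ℝ f x Z := by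
  have h := InnerProductSpace.toDual_symm_apply (𝕜 := ℝ) (x := (⟨Z, hZ⟩ : embTangentSpace M x))
    (y := (fderiv ℝ f x).comp (embTangentSpace M x).subtypeL)
  exact h

theorem coe_riemannianGradient_eq {M : Set E} {f : E → ℝ} {x ξ : E}
    (hξ : ξ ∈ embTangentSpace M x)
    (h : ∀ Z ∈ embTangentSpace M x, inner ℝ ξ Z = fderiv ℝ f x Z) :
    (riemannianGradient M f x : E) = ξ := by
  have hmem := (embTangentSpace M x).sub_mem (riemannianGradient M f x).2 hξ
  rw [← sub_eq_zero, ← inner_self_eq_zero (𝕜 := ℝ), inner_sub_left,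
    inner_riemannianGradient M f x hmem, h _ hmem, sub_self]

theorem riemannianGradient_eq_zero_iff {M : Set E} {f : E → ℝ} {x : E} :
    riemannianGradient M f x = 0 ↔ ∀ Z ∈ embTangentSpace M x, fderiv ℝ f x Z = 0 := by
  refine ⟨fun h Z hZ => ?_, fun h => ?_⟩
  · rw [← inner_riemannianGradient M f x hZ, h]
    simp
  · exact Subtype.ext (coe_riemannianGradient_eq (Submodule.zero_mem _) fun Z hZ => by
      rw [h Z hZ]; exact inner_zero_left Z)

theorem ContDiff.gradient {f : F → ℝ} {m n : WithTop ℕ∞} (hf : ContDiff ℝ n f)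
    (hmn : m + 1 ≤ n) : ContDiff ℝ m (gradient f) :=
  (InnerProductSpace.toDual ℝ F).symm.toContinuousLinearEquiv.contDiff.comp
    (hf.fderiv_right hmn)

variable {M : Set E} {Φ : F → E} {f : E → ℝ} {y : F}

/-- The first-order conditions agree as soon as the differential of the parametrization is onto
the tangent space. -/
theorem isEuclideanFOSP_comp_iff (hΦ : ContDiff ℝ ∞ Φ) (hf : DifferentiableAt ℝ f (Φ y))
    (hM : ∀ᶠ z in 𝓝 y, Φ z ∈ M)
    (hT : ∀ Z ∈ embTangentSpace M (Φ y), ∃ B, fderiv ℝ Φ y B = Z) :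
    IsEuclideanFOSP (f ∘ Φ) y ↔ IsRiemannianFOSP M f (Φ y) := by
  have hd : fderiv ℝ (f ∘ Φ) y = (fderiv ℝ f (Φ y)).comp (fderiv ℝ Φ y) :=
    fderiv_comp y hf (hΦ.differentiable (by simp) y)
  rw [IsRiemannianFOSP, riemannianGradient_eq_zero_iff, IsEuclideanFOSP, gradient,
    LinearIsometryEquiv.map_eq_zero_iff, hd]
  refine ⟨fun h => ⟨hM.self_of_nhds, fun Z hZ => ?_⟩, fun h => ?_⟩
  · obtain ⟨B, rfl⟩ := hT Z hZ
    simpa using DFunLike.congr_fun h B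
  · ext B
    exact h.2 _ (fderiv_mem_embTangentSpace hΦ hM B)

/-- At a stationary point the Hessian of `f ∘ Φ` is the pullback of the Riemannian Hessian of `f`
along `dΦ`. Near `y` one has `⟨∇(f ∘ Φ), B⟩ = ⟨(grad f) ∘ Φ, dΦ[B]⟩`; differentiating at `y`, the
term with the second derivative of `Φ` is paired with `grad f (Φ y) = 0`. -/
theorem inner_euclideanHessian_comp (hΦ : ContDiff ℝ ∞ Φ) (hf : ContDiff ℝ 2 f)
    (hM : ∀ᶠ z in 𝓝 y, Φ z ∈ M)
    (hV : DifferentiableWithinAt ℝ (fun x => (riemannianGradient M f x : E)) M (Φ y))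
    (h0 : riemannianGradient M f (Φ y) = 0) (B : F) (Z : embTangentSpace M (Φ y))
    (hZ : fderiv ℝ Φ y B = Z) :
    inner ℝ (euclideanHessian (f ∘ Φ) y B) B = inner ℝ (riemannianHessian M f (Φ y) Z) Z := by
  set V : E → E := fun x => (riemannianGradient M f x : E) with hVdef
  have hV0 : V (Φ y) = 0 := by simp [hVdef, h0]
  have hev : (fun z => inner ℝ (gradient (f ∘ Φ) z) B) =ᶠ[𝓝 y]
      fun z => inner ℝ (V (Φ z)) (fderiv ℝ Φ z B) := by
    filter_upwards [hM.eventually_nhds] with z hz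
    rw [inner_gradient_left, fderiv_comp z (hf.differentiable (by simp) _)
      (hΦ.differentiable (by simp) z),
      inner_riemannianGradient M f _ (fderiv_mem_embTangentSpace hΦ hz B)]
    rfl
  have hg : HasFDerivAt (gradient (f ∘ Φ)) (euclideanHessian (f ∘ Φ) y) y :=
    ((((hf.comp (contDiff_infty.1 hΦ 2)).gradient
      (m := 1) (by norm_num)).differentiable (by simp)) y).hasFDerivAt
  have h1 := hg.inner ℝ (hasFDerivAt_const B y)
  have hVΦ : HasFDerivAt (fun z => V (Φ z))
      ((fderivWithin ℝ V M (Φ y)).comp (fderiv ℝ Φ y)) y :=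
    hV.hasFDerivWithinAt.comp_hasFDerivAt y (hΦ.differentiable (by simp) y).hasFDerivAt hM
  have hdΦ : HasFDerivAt (fun z => fderiv ℝ Φ z B) (fderiv ℝ (fun z => fderiv ℝ Φ z B) y) y :=
    ((((contDiff_infty.1 hΦ 2).fderiv_right (m := 1) (by norm_num)).clm_apply
      contDiff_const).differentiable (by simp) y).hasFDerivAt
  have h2 := hVΦ.inner ℝ hdΦ
  have h3 := DFunLike.congr_fun (h1.unique (h2.congr_of_eventuallyEq hev)) B
  have h4 : inner ℝ (riemannianHessian M f (Φ y) Z) Z =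
      inner ℝ (fderivWithin ℝ V M (Φ y) (Z : E)) (Z : E) := by
    rw [riemannianHessian, riemannianConnection]
    simp only [ContinuousLinearMap.comp_apply, Submodule.subtypeL_apply]
    exact Submodule.inner_orthogonalProjectionOnto_eq_of_mem_right _ _
  rw [h4]
  simpa [hV0, hZ] using h3

/-- The second-order conditions agree when moreover the Riemannian gradient field is differentiable
along `M`. -/
theorem isEuclideanSOSP_comp_iff (hΦ : ContDiff ℝ ∞ Φ) (hf : ContDiff ℝ 2 f)
    (hM : ∀ᶠ z in 𝓝 y, Φ z ∈ M)
    (hT : ∀ Z ∈ embTangentSpace M (Φ y), ∃ B, fderiv ℝ Φ y B = Z)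
    (hV : DifferentiableWithinAt ℝ (fun x => (riemannianGradient M f x : E)) M (Φ y)) :
    IsEuclideanSOSP (f ∘ Φ) y ↔ IsRiemannianSOSP M f (Φ y) := by
  have hF := isEuclideanFOSP_comp_iff hΦ (hf.differentiable (by simp) (Φ y)) hM hT
  constructor
  · rintro ⟨hg, hH⟩
    obtain ⟨hx, h0⟩ := hF.1 hg
    refine ⟨hx, h0, fun Z => ?_⟩
    obtain ⟨B, hB⟩ := hT Z Z.2
    rw [← inner_euclideanHessian_comp hΦ hf hM hV h0 B Z hB]
    exact hH B
  · rintro ⟨hx, h0, hH⟩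
    refine ⟨hF.2 ⟨hx, h0⟩, fun B => ?_⟩
    rw [inner_euclideanHessian_comp hΦ hf hM hV h0 B
      ⟨_, fderiv_mem_embTangentSpace hΦ hM B⟩ rfl]
    exact hH _

end Parametrization

/-! ### Differential calculus of matrix operations -/

section Calculus

variable {E : Type*} [NormedAddCommGroup E] [NormedSpace ℝ E] {l m n : ℕ} {k : WithTop ℕ∞} {x : E}

theorem ContDiffAt.matrixMul {A : E → Matrix (Fin l) (Fin m) ℝ} {B : E → Matrix (Fin m) (Fin n) ℝ}
    (hA : ContDiffAt ℝ k A x) (hB : ContDiffAt ℝ k B x) :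
    ContDiffAt ℝ k (fun z => A z * B z) x :=
  ((LinearMap.mk₂ ℝ (fun (A : Matrix (Fin l) (Fin m) ℝ) (B : Matrix (Fin m) (Fin n) ℝ) => A * B)
    Matrix.add_mul Matrix.smul_mul Matrix.mul_add
    (fun c A B => Matrix.mul_smul A c B)).toContinuousBilinearMap.isBoundedBilinearMap.contDiff
    |>.contDiffAt).comp x (hA.prodMk hB)

theorem ContDiffAt.matrixTranspose {A : E → Matrix (Fin m) (Fin n) ℝ}
    (hA : ContDiffAt ℝ k A x) : ContDiffAt ℝ k (fun z => (A z)ᵀ) x :=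
  ((Matrix.transposeLinearEquiv (Fin m) (Fin n) ℝ ℝ).toLinearMap.toContinuousLinearMap.contDiff
    |>.contDiffAt).comp x hA

theorem ContDiffAt.matrixInv {A : E → Matrix (Fin n) (Fin n) ℝ}
    (hA : ContDiffAt ℝ k A x) (hx : IsUnit (A x).det) : ContDiffAt ℝ k (fun z => (A z)⁻¹) x := by
  let _ : NormedRing (Matrix (Fin n) (Fin n) ℝ) := Matrix.frobeniusNormedRing
  let _ : NormedAlgebra ℝ (Matrix (Fin n) (Fin n) ℝ) := Matrix.frobeniusNormedAlgebra
  obtain ⟨u, hu⟩ := (Matrix.isUnit_iff_isUnit_det _).2 hx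
  have h := contDiffAt_ringInverse ℝ u (n := k)
  rw [hu] at h
  simp only [Matrix.nonsing_inv_eq_ringInverse]
  exact h.comp x hA

theorem ContinuousAt.matrixDet {E : Type*} [TopologicalSpace E] {x : E}
    {A : E → Matrix (Fin n) (Fin n) ℝ} (hA : ContinuousAt A x) :
    ContinuousAt (fun z => (A z).det) x :=
  (continuous_id.matrix_det.continuousAt (x := A x)).comp hA

end Calculus

/-! ### Tangent spaces of the manifold of positive semidefinite matrices of fixed rank -/

section PSD

variable {p r : ℕ}

theorem contDiff_mul_transpose :
    ContDiff ℝ ∞ fun Y : Matrix (Fin p) (Fin r) ℝ => Y * Yᵀ :=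
  contDiff_iff_contDiffAt.2 fun _ => contDiffAt_id.matrixMul contDiffAt_id.matrixTranspose

theorem fderiv_mul_transpose (Y B : Matrix (Fin p) (Fin r) ℝ) :
    fderiv ℝ (fun Y : Matrix (Fin p) (Fin r) ℝ => Y * Yᵀ) Y B = Y * Bᵀ + B * Yᵀ := by
  refine fderiv_apply_eq_of_quadratic (c := B * Bᵀ)
    (contDiff_mul_transpose.differentiable (by simp) Y) fun t => ?_
  simp only [Matrix.transpose_add, Matrix.transpose_smul, Matrix.add_mul, Matrix.mul_add,
    Matrix.smul_mul, Matrix.mul_smul]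
  module

theorem mul_transpose_mem_psdRankManifold {Y : Matrix (Fin p) (Fin r) ℝ} (hY : Y.rank = r) :
    Y * Yᵀ ∈ psdRankManifold p r := by
  refine ⟨?_, by rw [Matrix.rank_self_mul_transpose, hY]⟩
  simpa using Matrix.posSemidef_self_mul_conjTranspose Y

theorem isUnit_det_transpose_mul_self {Y : Matrix (Fin p) (Fin r) ℝ} (hY : Y.rank = r) :
    IsUnit (Yᵀ * Y).det := by
  rw [← Matrix.isUnit_iff_isUnit_det, ← Matrix.mulVec_injective_iff_isUnit]
  have hk : Module.finrank ℝ (LinearMap.ker (Yᵀ * Y).mulVecLin) = 0 := by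
    have h := (Yᵀ * Y).mulVecLin.finrank_range_add_finrank_ker
    have h' : Module.finrank ℝ (LinearMap.range (Yᵀ * Y).mulVecLin) = r :=
      (Matrix.rank_transpose_mul_self Y).trans hY
    simp only [Module.finrank_fin_fun] at h
    omega
  exact LinearMap.ker_eq_bot.1 (Submodule.finrank_eq_zero.1 hk)

theorem eventually_rank_eq {Y : Matrix (Fin p) (Fin r) ℝ} (hY : Y.rank = r) :
    ∀ᶠ Z in 𝓝 Y, Z.rank = r := by
  have hc : ContinuousAt (fun Z : Matrix (Fin p) (Fin r) ℝ => (Zᵀ * Z).det) Y :=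
    ((contDiffAt_id (n := 0)).matrixTranspose.matrixMul contDiffAt_id).continuousAt.matrixDet
  filter_upwards [hc.eventually_ne (isUnit_det_transpose_mul_self hY).ne_zero] with Z hZ
  rw [← Matrix.rank_transpose_mul_self, Matrix.rank_of_det_ne_zero hZ, Fintype.card_fin]

variable {X P Q : Matrix (Fin p) (Fin p) ℝ}

/-- Every matrix `A X + X Aᵀ` is tangent at `X`: it is the velocity of the congruences
`(1 + t A) X (1 + t A)ᵀ`, which keep the rank of `X` as long as `1 + t A` is invertible. -/
theorem mul_add_mul_transpose_mem_embTangentSpace (hX : X ∈ psdRankManifold p r)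
    (A : Matrix (Fin p) (Fin p) ℝ) :
    A * X + X * Aᵀ ∈ embTangentSpace (psdRankManifold p r) X := by
  let Φ : ℝ → Matrix (Fin p) (Fin p) ℝ := fun t => (1 + t • A) * X * (1 + t • A)ᵀ
  have hl : ContDiff ℝ ∞ fun t : ℝ => (1 : Matrix (Fin p) (Fin p) ℝ) + t • A := by fun_prop
  have hΦ : ContDiff ℝ ∞ Φ := contDiff_iff_contDiffAt.2 fun t =>
    (hl.contDiffAt.matrixMul contDiffAt_const).matrixMul hl.contDiffAt.matrixTranspose
  have hM : ∀ᶠ t in 𝓝 (0 : ℝ), Φ t ∈ psdRankManifold p r := by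
    have hc : ContinuousAt (fun t : ℝ => ((1 : Matrix (Fin p) (Fin p) ℝ) + t • A).det) 0 :=
      hl.continuous.continuousAt.matrixDet
    filter_upwards [hc.eventually_ne (by simp : _ ≠ (0 : ℝ))] with t ht
    refine ⟨?_, ?_⟩
    · simpa using hX.1.mul_mul_conjTranspose_same (1 + t • A)
    · rw [Matrix.rank_mul_eq_left_of_det_ne_zero _ _ (by rwa [Matrix.det_transpose]),
        Matrix.rank_mul_eq_right_of_det_ne_zero _ _ ht, hX.2]
  have h0 : Φ 0 = X := by simp [Φ]
  have h := fderiv_mem_embTangentSpace hΦ hM 1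
  have hd : fderiv ℝ Φ 0 1 = A * X + X * Aᵀ := by
    refine fderiv_apply_eq_of_quadratic (c := A * X * Aᵀ)
      (hΦ.differentiable (by simp) 0) fun t => ?_
    rw [h0]
    simp only [Φ, Matrix.transpose_add, Matrix.transpose_smul, Matrix.add_mul, Matrix.mul_add,
      Matrix.smul_mul, Matrix.mul_smul, Matrix.transpose_one, Matrix.one_mul,
      zero_add, smul_eq_mul, mul_one]
    module
  have h' : A * X + X * Aᵀ ∈ embTangentSpace (psdRankManifold p r) (Φ 0) :=
    (congrArg (· ∈ embTangentSpace (psdRankManifold p r) (Φ 0)) hd).mp h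
  rwa [h0] at h'

theorem transpose_eq_of_mem_embTangentSpace {W : Matrix (Fin p) (Fin p) ℝ}
    (hW : W ∈ embTangentSpace (psdRankManifold p r) X) : Wᵀ = W := by
  induction hW using Submodule.span_induction with
  | mem v hv =>
    obtain ⟨ε, γ, hε, -, hM, -, hγ⟩ := hv
    have h1 : HasDerivAt (fun t => (γ t)ᵀ) vᵀ 0 :=
      ((Matrix.transposeLinearEquiv (Fin p) (Fin p) ℝ ℝ).toLinearMap.toContinuousLinearMap
        |>.hasFDerivAt).comp_hasDerivAt (0 : ℝ) hγ
    refine h1.unique (hγ.congr_of_eventuallyEq ?_)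
    filter_upwards [Ioo_mem_nhds (neg_lt_zero.2 hε) hε] with t ht
    simpa [Matrix.IsHermitian] using (hM t ht).1.isHermitian.eq
  | zero => simp
  | add u v _ _ hu hv => simp [hu, hv]
  | smul c v _ hv => simp [hv]

/-- A velocity `W` at `X` has vanishing quadratic form on `ker X`: along the curve the form
`u ↦ uᵀ γ(t) u` is nonnegative, and for `u ∈ ker X` it attains its minimum `0` at `t = 0`. -/
theorem dotProduct_mulVec_eq_zero_of_mem_embTangentSpace {W : Matrix (Fin p) (Fin p) ℝ}
    (hW : W ∈ embTangentSpace (psdRankManifold p r) X) {u : Fin p → ℝ} (hu : X *ᵥ u = 0) :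
    u ⬝ᵥ W *ᵥ u = 0 := by
  let q : Matrix (Fin p) (Fin p) ℝ →ₗ[ℝ] ℝ :=
    { toFun := fun A => u ⬝ᵥ A *ᵥ u
      map_add' := fun A B => by simp [Matrix.add_mulVec]
      map_smul' := fun c A => by simp [Matrix.smul_mulVec] }
  change q W = 0
  induction hW using Submodule.span_induction with
  | mem v hv =>
    obtain ⟨ε, γ, hε, -, hM, h0, hγ⟩ := hv
    have h1 : HasDerivAt (fun t => q (γ t)) (q v) 0 :=
      (q.toContinuousLinearMap.hasFDerivAt).comp_hasDerivAt (0 : ℝ) hγ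
    refine IsLocalMin.hasDerivAt_eq_zero ?_ h1
    filter_upwards [Ioo_mem_nhds (neg_lt_zero.2 hε) hε] with t ht
    have h2 : q (γ 0) = 0 := by simp [q, h0, hu]
    rw [h2]
    simpa [q] using (hM t ht).1.dotProduct_mulVec_nonneg u
  | zero => simp
  | add u v _ _ hu hv => simp [hu, hv]
  | smul c v _ hv => simp [hv]

theorem Matrix.eq_zero_of_dotProduct_mulVec_self {A : Matrix (Fin p) (Fin p) ℝ} (hA : Aᵀ = A)
    (h : ∀ u, u ⬝ᵥ A *ᵥ u = 0) : A = 0 := by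
  -- polarization on the standard basis vectors
  ext i j
  have hij := h (Pi.single i 1 + Pi.single j 1)
  have hi := h (Pi.single i 1)
  have hj := h (Pi.single j 1)
  have hs : A j i = A i j := congrFun (congrFun hA i) j
  simp only [Matrix.mulVec_add, add_dotProduct, dotProduct_add, Matrix.mulVec_single_one,
    single_one_dotProduct, Matrix.col_apply] at hij hi hj
  simp only [Matrix.zero_apply]
  linarith

/-- A symmetric matrix `W` whose compression to `ker X` vanishes equals `P W + W P - P W P`, where
`P` is the orthogonal projector onto the range of `X`. As `P = X Q` and its transpose `P = Qᵀ X`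
factor through `X`, such a `W` has the form `A X + X Aᵀ`. -/
theorem exists_eq_mul_add_mul_transpose (hXs : Xᵀ = X) (hP : Pᵀ = P) (hPQ : P = X * Q)
    {W : Matrix (Fin p) (Fin p) ℝ} (hs : Wᵀ = W) (hN : (1 - P) * W * (1 - P) = 0) :
    ∃ A, W = A * X + X * Aᵀ := by
  have hQX : Qᵀ * X = P := by
    rw [← hP, hPQ, Matrix.transpose_mul, hXs]
  have e1 : (W * Qᵀ - (1 / 2 : ℝ) • (P * W * Qᵀ)) * X = W * P - (1 / 2 : ℝ) • (P * W * P) := by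
    rw [Matrix.sub_mul, Matrix.smul_mul, Matrix.mul_assoc, Matrix.mul_assoc (P * W), hQX]
  have e2 : X * (W * Qᵀ - (1 / 2 : ℝ) • (P * W * Qᵀ))ᵀ
      = P * W - (1 / 2 : ℝ) • (P * W * P) := by
    have := congrArg Matrix.transpose e1
    rw [Matrix.transpose_mul, hXs] at this
    rw [this]
    simp [Matrix.transpose_mul, hP, hs, Matrix.mul_assoc]
  refine ⟨W * Qᵀ - (1 / 2 : ℝ) • (P * W * Qᵀ), ?_⟩
  rw [e1, e2]
  have e3 : (1 - P) * W * (1 - P) = W - P * W - W * P + P * W * P := by noncomm_ring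
  rw [e3] at hN
  calc W = P * W + W * P - P * W * P := by
        rw [← sub_eq_zero, ← hN]
        abel
    _ = _ := by module

/-- The tangent space at `X`, in terms of the orthogonal projector `P` onto the range of `X`
(a symmetric matrix `P = X Q` with `P X = X`): the symmetric matrices whose compression to the
kernel of `X` vanishes. -/
theorem mem_embTangentSpace_psdRankManifold_iff (hX : X ∈ psdRankManifold p r) (hP : Pᵀ = P)
    (hPX : P * X = X) (hPQ : P = X * Q) {W : Matrix (Fin p) (Fin p) ℝ} :
    W ∈ embTangentSpace (psdRankManifold p r) X ↔ Wᵀ = W ∧ (1 - P) * W * (1 - P) = 0 := by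
  have hXs : Xᵀ = X := by simpa using hX.1.isHermitian.eq
  have hXP : X * P = X := by
    have := congrArg Matrix.transpose hPX
    rwa [Matrix.transpose_mul, hP, hXs] at this
  constructor
  · intro hW
    have hs := transpose_eq_of_mem_embTangentSpace hW
    refine ⟨hs, Matrix.eq_zero_of_dotProduct_mulVec_self ?_ fun u => ?_⟩
    · simp [Matrix.transpose_mul, hP, hs, Matrix.mul_assoc]
    · have hu : X *ᵥ ((1 - P) *ᵥ u) = 0 := by
        rw [Matrix.mulVec_mulVec, Matrix.mul_sub, hXP, Matrix.mul_one, sub_self, Matrix.zero_mulVec]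
      have h := dotProduct_mulVec_eq_zero_of_mem_embTangentSpace hW hu
      rw [← h]
      have hN : (1 - P)ᵀ = 1 - P := by simp [hP]
      rw [Matrix.mul_assoc, ← Matrix.mulVec_mulVec, ← Matrix.mulVec_mulVec,
        Matrix.dotProduct_mulVec, ← Matrix.mulVec_transpose, hN]
  · rintro ⟨hs, hN⟩
    obtain ⟨A, rfl⟩ := exists_eq_mul_add_mul_transpose hXs hP hPQ hs hN
    exact mul_add_mul_transpose_mem_embTangentSpace hX A

theorem inner_matrix_eq_trace {m n : ℕ} (A B : Matrix (Fin m) (Fin n) ℝ) :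
    inner ℝ A B = (Aᵀ * B).trace := rfl

/-- The Riemannian gradient `S - (1 - P) S (1 - P)`, where `S` is the symmetric part of the
Euclidean gradient: the orthogonal projection of the latter onto the tangent space. -/
theorem coe_riemannianGradient_psdRankManifold (f : Matrix (Fin p) (Fin p) ℝ → ℝ)
    (hX : X ∈ psdRankManifold p r) (hP : Pᵀ = P) (hPX : P * X = X) (hPQ : P = X * Q) :
    (riemannianGradient (psdRankManifold p r) f X : Matrix (Fin p) (Fin p) ℝ) =
      (1 / 2 : ℝ) • (gradient f X + (gradient f X)ᵀ) -
        (1 - P) * ((1 / 2 : ℝ) • (gradient f X + (gradient f X)ᵀ)) * (1 - P) := by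
  set G := gradient f X with hG
  set S := (1 / 2 : ℝ) • (G + Gᵀ) with hS
  have hSs : Sᵀ = S := by simp [hS, add_comm]
  have hPP : P * P = P := by
    calc P * P = P * X * Q := by rw [Matrix.mul_assoc, ← hPQ]
      _ = P := by rw [hPX, ← hPQ]
  have hN : (1 - P)ᵀ = 1 - P := by simp [hP]
  have hNN : (1 - P) * (1 - P) = 1 - P := by
    rw [Matrix.mul_sub, Matrix.sub_mul, Matrix.sub_mul, hPP]
    simp
  refine coe_riemannianGradient_eq ?_ fun Z hZ => ?_
  · rw [mem_embTangentSpace_psdRankManifold_iff hX hP hPX hPQ]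
    refine ⟨?_, ?_⟩
    · rw [Matrix.transpose_sub, Matrix.transpose_mul, Matrix.transpose_mul, hN, hSs,
        Matrix.mul_assoc]
    · have : (1 - P) * (S - (1 - P) * S * (1 - P)) * (1 - P) =
          (1 - P) * S * (1 - P) - ((1 - P) * (1 - P)) * S * ((1 - P) * (1 - P)) := by
        generalize 1 - P = N
        simp only [Matrix.mul_sub, Matrix.sub_mul, Matrix.mul_assoc]
      rw [this, hNN, sub_self]
  · rw [mem_embTangentSpace_psdRankManifold_iff hX hP hPX hPQ] at hZ
    obtain ⟨hZs, hZN⟩ := hZ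
    rw [← inner_gradient_left, ← hG, inner_sub_left]
    have h1 : inner ℝ ((1 - P) * S * (1 - P)) Z = 0 := by
      rw [inner_matrix_eq_trace, Matrix.transpose_mul, Matrix.transpose_mul, hN, hSs,
        Matrix.mul_assoc, Matrix.trace_mul_comm, Matrix.mul_assoc, Matrix.mul_assoc,
        ← Matrix.mul_assoc (1 - P) Z, hZN, Matrix.mul_zero, Matrix.trace_zero]
    have h2 : inner ℝ Gᵀ Z = inner ℝ G Z := by
      rw [inner_matrix_eq_trace, inner_matrix_eq_trace, Matrix.transpose_transpose,
        ← Matrix.trace_transpose, Matrix.transpose_mul, hZs, Matrix.trace_mul_comm]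
    rw [h1, sub_zero, hS, real_inner_smul_left, inner_add_left, h2]
    ring

/-! ### A smooth local formula for the projector onto the range -/

/-- The orthogonal projector onto the column space of `X Y`, when `X Y` has full column rank and
`X` is symmetric. It is a rational function of `X`. -/
noncomputable def rangeProjector (Y : Matrix (Fin p) (Fin r) ℝ) (X : Matrix (Fin p) (Fin p) ℝ) :
    Matrix (Fin p) (Fin p) ℝ :=
  X * (Y * ((X * Y)ᵀ * (X * Y))⁻¹ * (X * Y)ᵀ)

variable {Y : Matrix (Fin p) (Fin r) ℝ}

theorem rangeProjector_transpose : (rangeProjector Y X)ᵀ = rangeProjector Y X := by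
  simp only [rangeProjector, Matrix.transpose_mul, Matrix.transpose_transpose,
    Matrix.transpose_nonsing_inv, Matrix.mul_assoc]

/-- If `X` has rank `r` and `X Y` has full column rank `r`, the two have the same range, so that
`X = X Y Z` for some `Z`. -/
theorem rangeProjector_mul_self (hX : X.rank = r) (hd : ((X * Y)ᵀ * (X * Y)).det ≠ 0) :
    rangeProjector Y X * X = X := by
  have hXY : (X * Y).rank = r := by
    rw [← Matrix.rank_transpose_mul_self, Matrix.rank_of_det_ne_zero hd, Fintype.card_fin]
  have hle : LinearMap.range (X * Y).mulVecLin ≤ LinearMap.range X.mulVecLin := by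
    rw [Matrix.mulVecLin_mul]
    exact LinearMap.range_comp_le_range _ _
  have heq : LinearMap.range (X * Y).mulVecLin = LinearMap.range X.mulVecLin :=
    Submodule.eq_of_le_of_finrank_eq hle (hXY.trans hX.symm)
  have hcol : ∀ j, ∃ z : Fin r → ℝ, (X * Y) *ᵥ z = X.col j := by
    intro j
    have : X.col j ∈ LinearMap.range (X * Y).mulVecLin := by
      rw [heq]
      exact ⟨Pi.single j 1, by simp⟩
    exact this
  choose z hz using hcol
  have hZ : X = X * Y * (Matrix.of z)ᵀ := by
    ext i j
    exact (congrFun (hz j) i).symm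
  have h : rangeProjector Y X * (X * Y) = X * Y := by
    rw [rangeProjector]
    simp only [Matrix.mul_assoc]
    simp only [← Matrix.mul_assoc X Y]
    rw [Matrix.nonsing_inv_mul _ (isUnit_iff_ne_zero.2 hd), Matrix.mul_one]
  calc rangeProjector Y X * X
      = rangeProjector Y X * (X * Y) * (Matrix.of z)ᵀ := by rw [Matrix.mul_assoc, ← hZ]
    _ = X := by rw [h, ← hZ]

/-- At `X = Y Yᵀ` the Gram matrix of `X Y` is `(Yᵀ Y)³`. -/
theorem det_gram_self_mul_transpose_mul_self_ne_zero (hY : Y.rank = r) :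
    ((Y * Yᵀ * Y)ᵀ * (Y * Yᵀ * Y)).det ≠ 0 := by
  have e : (Y * Yᵀ * Y)ᵀ * (Y * Yᵀ * Y) = Yᵀ * Y * (Yᵀ * Y) * (Yᵀ * Y) := by
    simp only [Matrix.transpose_mul, Matrix.transpose_transpose, Matrix.mul_assoc]
  have h := (isUnit_det_transpose_mul_self hY).ne_zero
  rw [e, Matrix.det_mul, Matrix.det_mul]
  exact mul_ne_zero (mul_ne_zero h h) h

/-- On `M`, near `Y Yᵀ`, the gradient field agrees with a map that is differentiable at `Y Yᵀ` in the
whole matrix space: the explicit formula with the projector `rangeProjector Y`. -/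
theorem differentiableWithinAt_riemannianGradient {f : Matrix (Fin p) (Fin p) ℝ → ℝ}
    (hf : ContDiff ℝ 2 f) (hY : Y.rank = r) :
    DifferentiableWithinAt ℝ
      (fun X => (riemannianGradient (psdRankManifold p r) f X : Matrix (Fin p) (Fin p) ℝ))
      (psdRankManifold p r) (Y * Yᵀ) := by
  have hK : ∀ X₀ : Matrix (Fin p) (Fin p) ℝ,
      ContDiffAt ℝ 1 (fun X : Matrix (Fin p) (Fin p) ℝ => (X * Y)ᵀ * (X * Y)) X₀ := fun X₀ =>
    have h := (contDiffAt_id (x := X₀)).matrixMul (contDiffAt_const (c := Y))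
    h.matrixTranspose.matrixMul h
  have hu := det_gram_self_mul_transpose_mul_self_ne_zero hY
  have hP : ContDiffAt ℝ 1 (rangeProjector Y) (Y * Yᵀ) :=
    contDiffAt_id.matrixMul ((contDiffAt_const.matrixMul
      ((hK _).matrixInv (isUnit_iff_ne_zero.2 hu))).matrixMul
      (contDiffAt_id.matrixMul contDiffAt_const).matrixTranspose)
  have hN := (contDiffAt_const (c := (1 : Matrix (Fin p) (Fin p) ℝ))).sub hP
  have hG : ContDiffAt ℝ 1 (gradient f) (Y * Yᵀ) := (hf.gradient (by norm_num)).contDiffAt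
  have hS := (hG.add hG.matrixTranspose).const_smul (1 / 2 : ℝ)
  have hV := ((hS.sub ((hN.matrixMul hS).matrixMul hN)).differentiableAt
    (by simp)).differentiableWithinAt (s := psdRankManifold p r)
  have hev : ∀ᶠ X in 𝓝 (Y * Yᵀ), ((X * Y)ᵀ * (X * Y)).det ≠ 0 :=
    (hK _).continuousAt.matrixDet.eventually_ne hu
  refine hV.congr_of_eventuallyEq ?_ ?_
  · filter_upwards [self_mem_nhdsWithin, mem_nhdsWithin_of_mem_nhds hev] with X hX hd
    exact coe_riemannianGradient_psdRankManifold f hX rangeProjector_transpose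
      (rangeProjector_mul_self hX.2 hd) rfl
  · have hX := mul_transpose_mem_psdRankManifold hY
    exact coe_riemannianGradient_psdRankManifold f hX rangeProjector_transpose
      (rangeProjector_mul_self hX.2 hu) rfl

/-- The differential `B ↦ Y Bᵀ + B Yᵀ` maps onto the tangent space: a tangent vector at `Y Yᵀ` has
the form `A (Y Yᵀ) + (Y Yᵀ) Aᵀ`, which is the image of `B = A Y`. -/
theorem exists_fderiv_mul_transpose_eq (hY : Y.rank = r) {W : Matrix (Fin p) (Fin p) ℝ}
    (hW : W ∈ embTangentSpace (psdRankManifold p r) (Y * Yᵀ)) :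
    ∃ B, fderiv ℝ (fun Y : Matrix (Fin p) (Fin r) ℝ => Y * Yᵀ) Y B = W := by
  have hX := mul_transpose_mem_psdRankManifold hY
  have hPX := rangeProjector_mul_self hX.2 (det_gram_self_mul_transpose_mul_self_ne_zero hY)
  obtain ⟨hs, hN⟩ :=
    (mem_embTangentSpace_psdRankManifold_iff hX rangeProjector_transpose hPX rfl).1 hW
  obtain ⟨A, rfl⟩ := exists_eq_mul_add_mul_transpose (by simp) rangeProjector_transpose rfl hs hN
  refine ⟨A * Y, (fderiv_mul_transpose Y (A * Y)).trans ?_⟩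
  rw [Matrix.transpose_mul, Matrix.mul_assoc A, Matrix.mul_assoc Y, add_comm]

/-! ### Stationary points of the factorized objective -/

theorem isEuclideanFOSP_psdFactorObjective_iff {f : Matrix (Fin p) (Fin p) ℝ → ℝ}
    (hf : ContDiff ℝ 2 f) (hY : Y.rank = r) :
    IsEuclideanFOSP (psdFactorObjective f) Y ↔
      IsRiemannianFOSP (psdRankManifold p r) f (Y * Yᵀ) :=
  isEuclideanFOSP_comp_iff contDiff_mul_transpose (hf.differentiable (by simp) _)
    ((eventually_rank_eq hY).mono fun _ => mul_transpose_mem_psdRankManifold)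
    fun _ => exists_fderiv_mul_transpose_eq hY

theorem isEuclideanSOSP_psdFactorObjective_iff {f : Matrix (Fin p) (Fin p) ℝ → ℝ}
    (hf : ContDiff ℝ 2 f) (hY : Y.rank = r) :
    IsEuclideanSOSP (psdFactorObjective f) Y ↔
      IsRiemannianSOSP (psdRankManifold p r) f (Y * Yᵀ) :=
  isEuclideanSOSP_comp_iff contDiff_mul_transpose hf
    ((eventually_rank_eq hY).mono fun _ => mul_transpose_mem_psdRankManifold)
    (fun _ => exists_fderiv_mul_transpose_eq hY) (differentiableWithinAt_riemannianGradient hf hY)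

end PSD

theorem mainTheorem3 (p r : ℕ) (hr : 0 < r) (hrp : r ≤ p)
    (f : Matrix (Fin p) (Fin p) ℝ → ℝ) (hf : ContDiff ℝ 2 f) :
    (∀ Y : Matrix (Fin p) (Fin r) ℝ, Y.rank = r →
      (IsEuclideanFOSP (psdFactorObjective f) Y →
        IsRiemannianFOSP (psdRankManifold p r) f (Y * Yᵀ)) ∧
      (IsEuclideanSOSP (psdFactorObjective f) Y →
        IsRiemannianSOSP (psdRankManifold p r) f (Y * Yᵀ))) ∧
    (∀ X : Matrix (Fin p) (Fin p) ℝ,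
      (IsRiemannianFOSP (psdRankManifold p r) f X →
        ∀ Y : Matrix (Fin p) (Fin r) ℝ, Y * Yᵀ = X →
          IsEuclideanFOSP (psdFactorObjective f) Y) ∧
      (IsRiemannianSOSP (psdRankManifold p r) f X →
        ∀ Y : Matrix (Fin p) (Fin r) ℝ, Y * Yᵀ = X →
          IsEuclideanSOSP (psdFactorObjective f) Y)) := by
  have hrank : ∀ Y : Matrix (Fin p) (Fin r) ℝ, Y * Yᵀ ∈ psdRankManifold p r → Y.rank = r :=
    fun Y h => (Matrix.rank_self_mul_transpose Y).symm.trans h.2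
  refine ⟨fun Y hY => ⟨(isEuclideanFOSP_psdFactorObjective_iff hf hY).1,
    (isEuclideanSOSP_psdFactorObjective_iff hf hY).1⟩, fun X => ⟨?_, ?_⟩⟩
  · rintro hX Y rfl
    exact (isEuclideanFOSP_psdFactorObjective_iff hf (hrank Y hX.1)).2 hX
  · rintro hX Y rfl
    exact (isEuclideanSOSP_psdFactorObjective_iff hf (hrank Y hX.1)).2 hX
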